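/- Let $(B_t)_{t\ge 0}$ be a standard Brownian motion on a probability space, and put $$M_t=e^{B_t-t/2},\qquad A_t=\int_0^t M_s\,ds,$$ and, for a real number $\sigma>0$ (the volatility), $$M^{(\sigma)}_t=e^{\sigma B_t-\sigma^2t/2},\qquad A^{(\sigma)}_t=\int_0^t M^{(\sigma)}_s\,ds .$$ Let $T_h>0$ be a horizon date, and let $T\mapsto P(0,T)$ be a continuous, monotone decreasing (not necessarily strictly) function from $[0,T_h]$ to $(0,\infty)$ with $P(0,0)=1$. In the general model with volatility $\sigma$ the long bond price is $$P(t,T_h)=\Big(\frac{P(0,t)}{P(0,T_h)}\Big)^{\frac{-2M^{(\sigma)}_t}{2+\sigma^2A^{(\sigma)}_t\log[P(0,t)/P(0,T_h)]}},\qquad 0\le t\le T_h,$$ and for a maturity date $0\le T\le T_h$ the price of the $T$-maturity bond is $$P(t,T)=P(t,T_h)\Big(\frac{P(0,T)}{P(0,T_h)}\Big)^{\frac{2M^{(\sigma)}_t}{2+\sigma^2A^{(\sigma)}_t\log[P(0,T)/P(0,T_h)]}},\qquad 0\le t\le T .$$ **Proposition.** For every $\sigma>0$ and every maturity date $T\in[0,T_h]$,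 the discounted price process $$\Big(\frac{P(t,T)}{P(t,T_h)}\Big)_{0\le t\le T}$$ of the general model has the same distribution, as a process (that is, the same law on the space of functions $[0,T]\to\mathbb R$ with the product $\sigma$-algebra; equivalently, the same finite-dimensional distributions), as the process $$\Big(\Big(\frac{P(0,T)}{P(0,T_h)}\Big)^{\frac{2M_{\sigma^2t}}{2+A_{\sigma^2t}\log[P(0,T)/P(0,T_h)]}}\Big)_{0\le t\le T},$$ which is the discounted price process of the special model (the model with $\sigma=1$), with $\sigma^2t$ in place of $t$. -/

import Mathlib

open MeasureTheory ProbabilityTheory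
open scoped NNReal

namespace BondModel

noncomputable section

/-- The initial bond prices `T ↦ P(0,T)` on `[0,Th]`, for a horizon date `Th > 0`: a continuous,
monotone decreasing curve of positive numbers with `P(0,0) = 1`. The curve `p` is defined on all
of `ℝ≥0`, but only its values on `[0,Th]` matter. -/
structure IsCalibrationCurve (p : ℝ≥0 → ℝ) (Th : ℝ≥0) : Prop where
  horizon_pos : 0 < Th
  continuousOn : ContinuousOn p (Set.Iic Th)
  antitoneOn : AntitoneOn p (Set.Iic Th)
  pos : ∀ t ≤ Th, 0 < p t
  at_zero : p 0 = 1

variable {Ω : Type*}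

/-- The exponential martingale `M_t = exp (B_t - t / 2)`. -/
def M (B : ℝ≥0 → Ω → ℝ) (t : ℝ≥0) (ω : Ω) : ℝ :=
  Real.exp (B t ω - (t : ℝ) / 2)

/-- Its time integral `A_t = ∫_0^t M_s ds`. -/
def A (B : ℝ≥0 → Ω → ℝ) (t : ℝ≥0) (ω : Ω) : ℝ :=
  ∫ s in (0 : ℝ)..(t : ℝ), M B s.toNNReal ω

/-- The exponential martingale with volatility, `M^σ_t = exp (σ B_t - σ² t / 2)`. -/
def Mvol (σ : ℝ≥0) (B : ℝ≥0 → Ω → ℝ) (t : ℝ≥0) (ω : Ω) : ℝ :=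
  Real.exp ((σ : ℝ) * B t ω - (σ : ℝ) ^ 2 * (t : ℝ) / 2)

/-- Its time integral `A^σ_t = ∫_0^t M^σ_s ds`. -/
def Avol (σ : ℝ≥0) (B : ℝ≥0 → Ω → ℝ) (t : ℝ≥0) (ω : Ω) : ℝ :=
  ∫ s in (0 : ℝ)..(t : ℝ), Mvol σ B s.toNNReal ω

/-- The price `P(t,Th)` of the long bond in the general model with volatility `σ`. -/
def longBondPrice (p : ℝ≥0 → ℝ) (Th σ : ℝ≥0) (B : ℝ≥0 → Ω → ℝ) (t : ℝ≥0) (ω : Ω) : ℝ :=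
  (p t / p Th) ^
    (-2 * Mvol σ B t ω / (2 + (σ : ℝ) ^ 2 * Avol σ B t ω * Real.log (p t / p Th)))

/-- The price `P(t,T)`, for `t ≤ T`, of the bond of maturity `T` in the general model with
volatility `σ`. For `T = Th` the second factor is `1`, so this is the long bond price. -/
def bondPrice (p : ℝ≥0 → ℝ) (Th σ : ℝ≥0) (B : ℝ≥0 → Ω → ℝ) (T t : ℝ≥0) (ω : Ω) : ℝ :=
  longBondPrice p Th σ B t ω *
    (p T / p Th) ^
      (2 * Mvol σ B t ω / (2 + (σ : ℝ) ^ 2 * Avol σ B t ω * Real.log (p T / p Th)))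

/-- The discounted price process of the special model (volatility `1`),
`(P(0,T) / P(0,Th)) ^ (2 M_t / (2 + A_t log (P(0,T) / P(0,Th))))`. -/
def specialDiscountedPrice (p : ℝ≥0 → ℝ) (Th : ℝ≥0) (B : ℝ≥0 → Ω → ℝ) (T t : ℝ≥0) (ω : Ω) : ℝ :=
  (p T / p Th) ^ (2 * M B t ω / (2 + A B t ω * Real.log (p T / p Th)))

end

end BondModel

/-!
The special discounted price at time `σ² t` is the general discounted price built from the rescaled
process `W_t = σ⁻¹ B_{σ² t}` instead of `B`: indeed `M_{σ² t} = exp (σ W_t - σ² t / 2)`, and the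
substitution `s ↦ σ² s` turns `A_{σ² t}` into `σ² ∫_0^t exp (σ W_s - σ² s / 2) ds`
(`specialDiscountedPrice_sq_mul`). By Brownian scaling `W` is again a Brownian motion, so it remains
to see that the law of the discounted price process depends only on the law of the Brownian motion
(`identDistrib_discountedPrice`).

The time integral is not measurable for the product σ-algebra on the space of all
paths `ℝ≥0 → ℝ`, so the price process is written as a functional of the path restricted to the
rational times. A continuous path is recovered from this restriction by `rationalExtension`, a map
that is jointly measurable in the time and the restriction; hence the price functional is measurable
on `ℚ≥0 → ℝ`, where the laws of two Brownian motions agree because their finite-dimensional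
distributions do.
-/

namespace BondModel

open Filter
open scoped Topology

/-- The upper limit, as `n → ∞`, of the values of a function on the nonnegative rationals at the
points `⌊t n⌋ / n`, which converge to `t`. As a process on `ℚ≥0 → ℝ`, it extends functions on the
rational times to all times; it recovers a continuous path from its restriction. -/
noncomputable def rationalExtension (t : ℝ≥0) (y : ℚ≥0 → ℝ) : ℝ :=
  limsup (fun n : ℕ => y ((⌊t * n⌋₊ : ℚ≥0) / n)) atTop

lemma measurable_uncurry_rationalExtension :
    Measurable (fun z : ℝ≥0 × (ℚ≥0 → ℝ) => rationalExtension z.1 z.2) := by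
  refine Measurable.limsup fun n => ?_
  have h : Measurable (fun z : ℕ × (ℚ≥0 → ℝ) => z.2 ((z.1 : ℚ≥0) / n)) :=
    measurable_from_prod_countable_right fun k =>
      measurable_pi_apply ((k : ℚ≥0) / n)
  have hfloor : Measurable (fun z : ℝ≥0 × (ℚ≥0 → ℝ) => ⌊z.1 * n⌋₊) :=
    Nat.measurable_floor.comp (measurable_fst.mul_const _)
  exact h.comp (hfloor.prodMk measurable_snd)

lemma rationalExtension_restrict {f : ℝ≥0 → ℝ} (hf : Continuous f) (t : ℝ≥0) :
    rationalExtension t (fun q => f q) = f t := by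
  have h : Tendsto (fun n : ℕ => (((⌊t * n⌋₊ : ℚ≥0) / n : ℚ≥0) : ℝ≥0)) atTop (𝓝 t) := by
    rw [← NNReal.tendsto_coe]
    have := (tendsto_nat_floor_mul_div_atTop (R := ℝ) t.coe_nonneg).comp
      tendsto_natCast_atTop_atTop
    refine this.congr fun n => ?_
    have hfl : ⌊(t : ℝ) * n⌋₊ = ⌊t * n⌋₊ := Nonneg.nat_floor_coe (t * (n : ℝ≥0))
    simp [hfl]
  exact ((hf.tendsto t).comp h).limsup_eq

/-- The closed form of the discounted price `P(t,T) / P(t,Th)` in the model with volatility `σ`. -/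
noncomputable def discountedPrice {Ω : Type*} (p : ℝ≥0 → ℝ) (Th σ : ℝ≥0) (B : ℝ≥0 → Ω → ℝ)
    (T t : ℝ≥0) (ω : Ω) : ℝ :=
  (p T / p Th) ^
    (2 * Mvol σ B t ω / (2 + (σ : ℝ) ^ 2 * Avol σ B t ω * Real.log (p T / p Th)))

variable {Ω : Type*}

lemma bondPrice_div_longBondPrice {p : ℝ≥0 → ℝ} {Th : ℝ≥0} (hp : IsCalibrationCurve p Th)
    (σ : ℝ≥0) (B : ℝ≥0 → Ω → ℝ) (T : ℝ≥0) {t : ℝ≥0} (ht : t ≤ Th) (ω : Ω) :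
    bondPrice p Th σ B T t ω / longBondPrice p Th σ B t ω = discountedPrice p Th σ B T t ω := by
  have hpos : 0 < longBondPrice p Th σ B t ω :=
    Real.rpow_pos_of_pos (div_pos (hp.pos t ht) (hp.pos Th le_rfl)) _
  exact mul_div_cancel_left₀ _ hpos.ne'

lemma M_sq_mul {σ : ℝ≥0} (hσ : σ ≠ 0) (B : ℝ≥0 → Ω → ℝ) (t : ℝ≥0) (ω : Ω) :
    M B (σ ^ 2 * t) ω = Mvol σ (fun t ω => (σ : ℝ)⁻¹ * B (σ ^ 2 * t) ω) t ω := by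
  have : (σ : ℝ) ≠ 0 := by exact_mod_cast hσ
  simp [M, Mvol, mul_inv_cancel_left₀ this]

lemma A_sq_mul {σ : ℝ≥0} (hσ : σ ≠ 0) (B : ℝ≥0 → Ω → ℝ) (t : ℝ≥0) (ω : Ω) :
    A B (σ ^ 2 * t) ω =
      (σ : ℝ) ^ 2 * Avol σ (fun t ω => (σ : ℝ)⁻¹ * B (σ ^ 2 * t) ω) t ω := by
  have h := intervalIntegral.mul_integral_comp_mul_left
    (f := fun s : ℝ => M B s.toNNReal ω) (a := 0) (b := t) ((σ : ℝ) ^ 2)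
  rw [mul_zero] at h
  simp only [A, Avol, NNReal.coe_mul, NNReal.coe_pow]
  rw [← h]
  congr 2 with s
  rw [← M_sq_mul hσ, Real.toNNReal_mul (by positivity), Real.toNNReal_pow σ.coe_nonneg,
    Real.toNNReal_coe]

lemma specialDiscountedPrice_sq_mul (p : ℝ≥0 → ℝ) (Th : ℝ≥0) {σ : ℝ≥0} (hσ : σ ≠ 0)
    (B : ℝ≥0 → Ω → ℝ) (T t : ℝ≥0) (ω : Ω) :
    specialDiscountedPrice p Th B T (σ ^ 2 * t) ω =
      discountedPrice p Th σ (fun t ω => (σ : ℝ)⁻¹ * B (σ ^ 2 * t) ω) T t ω := by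
  rw [specialDiscountedPrice, discountedPrice, M_sq_mul hσ, A_sq_mul hσ]

lemma measurable_discountedPrice [MeasurableSpace Ω] (p : ℝ≥0 → ℝ) (Th σ : ℝ≥0)
    {B : ℝ≥0 → Ω → ℝ} (hB : Measurable (fun z : ℝ≥0 × Ω => B z.1 z.2)) (T t : ℝ≥0) :
    Measurable (discountedPrice p Th σ B T t) := by
  have hM : Measurable (fun z : ℝ≥0 × Ω => Mvol σ B z.1 z.2) := by
    unfold Mvol
    fun_prop
  have hA : Measurable (Avol σ B t) := by
    have h : StronglyMeasurable (fun z : Ω × ℝ => Mvol σ B z.2.toNNReal z.1) :=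
      (hM.comp ((measurable_real_toNNReal.comp measurable_snd).prodMk
        measurable_fst)).stronglyMeasurable
    have hA_eq : Avol σ B t =
        fun ω => ∫ s in Set.Ioc (0 : ℝ) t, Mvol σ B s.toNNReal ω :=
      funext fun ω => intervalIntegral.integral_of_le t.coe_nonneg
    rw [hA_eq]
    exact h.integral_prod_right'.measurable
  have hMt : Measurable (Mvol σ B t) := hM.comp measurable_prodMk_left
  unfold discountedPrice
  fun_prop

lemma discountedPrice_rationalExtension (p : ℝ≥0 → ℝ) (Th σ : ℝ≥0) {B : ℝ≥0 → Ω → ℝ} {ω : Ω}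
    (hω : Continuous (B · ω)) (T t : ℝ≥0) :
    discountedPrice p Th σ rationalExtension T t (fun q => B q ω) =
      discountedPrice p Th σ B T t ω := by
  simp [discountedPrice, Mvol, Avol, rationalExtension_restrict hω]

variable [MeasurableSpace Ω] {μ : Measure Ω} {B W : ℝ≥0 → Ω → ℝ}

lemma identDistrib_restrict_rational (hB : IsPreBrownianReal B μ) (hW : IsPreBrownianReal W μ) :
    IdentDistrib (fun ω (q : ℚ≥0) => B q ω) (fun ω (q : ℚ≥0) => W q ω) μ μ := by
  have := hB.isGaussianProcess.isProbabilityMeasure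
  refine (identDistrib_iff_forall_finset_identDistrib
    (X := fun (q : ℚ≥0) => B q) (Y := fun (q : ℚ≥0) => W q)
    (aemeasurable_pi_lambda _ fun q => hB.aemeasurable q)
    (aemeasurable_pi_lambda _ fun q => hW.aemeasurable q)).2 fun I => ?_
  classical
  have h := (hB.hasLaw (I.image (fun q : ℚ≥0 => (q : ℝ≥0)))).identDistrib
    (hW.hasLaw (I.image (fun q : ℚ≥0 => (q : ℝ≥0))))
  exact h.comp (u := fun x (q : I) => x ⟨(q : ℚ≥0), Finset.mem_image_of_mem _ q.2⟩) (by fun_prop)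

lemma identDistrib_discountedPrice (hB : IsBrownianReal B μ) (hW : IsBrownianReal W μ)
    (p : ℝ≥0 → ℝ) (Th σ T : ℝ≥0) :
    IdentDistrib (fun ω (t : Set.Iic T) => discountedPrice p Th σ B T t ω)
      (fun ω (t : Set.Iic T) => discountedPrice p Th σ W T t ω) μ μ := by
  have hΦ : Measurable (fun (y : ℚ≥0 → ℝ) (t : Set.Iic T) =>
      discountedPrice p Th σ rationalExtension T t y) :=
    measurable_pi_lambda _ fun t =>
      measurable_discountedPrice p Th σ measurable_uncurry_rationalExtension T t
  have h := (identDistrib_restrict_rational hB.toIsPreBrownianReal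
    hW.toIsPreBrownianReal).comp hΦ
  have hae {X : ℝ≥0 → Ω → ℝ} (hX : IsBrownianReal X μ) :
      ((fun (y : ℚ≥0 → ℝ) (t : Set.Iic T) => discountedPrice p Th σ rationalExtension T t y) ∘
        fun ω q => X q ω) =ᵐ[μ] fun ω (t : Set.Iic T) => discountedPrice p Th σ X T t ω := by
    filter_upwards [hX.cont] with ω hω
    exact funext fun t => discountedPrice_rationalExtension p Th σ hω T t
  exact ((IdentDistrib.of_ae_eq h.aemeasurable_fst (hae hB)).symm.trans h).trans
    (IdentDistrib.of_ae_eq h.aemeasurable_snd (hae hW))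

end BondModel

/-- The discounted price process `(P(t,T) / P(t,Th))`, `0 ≤ t ≤ T`, of the general model with
volatility `σ` has the same law on path space (`[0,T] → ℝ` with the product σ-algebra) as the
special discounted price process evaluated at the times `σ² t`. -/
theorem mainTheorem8 {Ω : Type*} [MeasurableSpace Ω] (μ : Measure Ω) [IsProbabilityMeasure μ]
    (B : ℝ≥0 → Ω → ℝ) (hB : IsBrownianReal B μ)
    (p : ℝ≥0 → ℝ) (Th : ℝ≥0) (hp : BondModel.IsCalibrationCurve p Th)
    (σ : ℝ≥0) (hσ : 0 < σ) (T : ℝ≥0) (hT : T ≤ Th) :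
    IdentDistrib
      (fun (ω : Ω) (t : Set.Iic T) =>
        BondModel.bondPrice p Th σ B T (t : ℝ≥0) ω / BondModel.longBondPrice p Th σ B (t : ℝ≥0) ω)
      (fun (ω : Ω) (t : Set.Iic T) =>
        BondModel.specialDiscountedPrice p Th B T (σ ^ 2 * (t : ℝ≥0)) ω)
      μ μ := by
  have hW : IsBrownianReal (fun t ω => (σ : ℝ)⁻¹ * B (σ ^ 2 * t) ω) μ := by
    simpa using hB.smul (pow_ne_zero 2 hσ.ne')
  convert BondModel.identDistrib_discountedPrice hB hW p Th σ T using 3 with ω t ω t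
  · exact BondModel.bondPrice_div_longBondPrice hp σ B T (t.2.trans hT) ω
  · exact BondModel.specialDiscountedPrice_sq_mul p Th hσ.ne' B T t ω
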